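/- Theorem 4.1. Let $G$ be a Hausdorff topological group with identity $1_G$, and suppose that $G$ is generated (algebraically) by an open subset $U \subseteq G$ whose closure in $G$ is compact. Then there is a set $S \subseteq G$ such that (i) $S$ is discrete in the subspace topology; (ii) $S \cup \{1_G\}$ is closed in $G$; (iii) the subgroup of $G$ generated by $S$ is dense in $G$ (that is, $S$ is a suitable set for $G$), and moreover $S \cup \{1_G\}$ is compact. -/

import Mathlib

/-- A subset `X` of a topological group `G` is a suitable set for `G` if it is discrete
(in the subspace topology), `X ∪ {1}` is closed in `G`, and the subgroup generated by `X`
is dense in `G`. -/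
structure IsSuitableSet {G : Type*} [Group G] [TopologicalSpace G] (X : Set G) : Prop where
  discrete : IsDiscrete X
  isClosed_union_one : IsClosed (X ∪ {1})
  dense_subgroup_closure : Dense (Subgroup.closure X : Set G)

open Filter Topology Pointwise

/-! It suffices to find a family that tends to `1` along the cofinite filter and generates a dense
subgroup: its nontrivial terms accumulate only at `1`. Such a family is built modulo smaller and
smaller compact normal subgroups `N`. For the start, `exists_normal_eq_iInter_nhds` gives a compact
normal `L = ⋂ n, V n`; modulo `L` the `V n` form a neighbourhood basis of `1`, and finitely many
generators per level give a null generating set. Zorn's lemma is then applied to pairs `(N, x)`,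
where going down means shrinking `N` and changing `x` only modulo the old `N`. Chains have bounds by
compactness of cosets (`exists_isSuitableFamilyMod_iInf`), and a nontrivial `N` can be shrunk
(`IsSuitableFamilyMod.exists_lt`), so a minimal `N` is `⊥`. Shrinking `N` needs new generators taken
from `N`. Indexing by `Subgroup G × G` reserves the slots `(N, g)` for them: by `mem_of_le` these
are trivial modulo `N` until then, so overwriting them is harmless. -/

/-! ### Finite generation up to a neighbourhood of the identity -/

theorem Subgroup.exists_finite_subset_mem_closure {K : Type*} [Group K] {O : Set K} {g : K}
    (hg : g ∈ Subgroup.closure O) :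
    ∃ F : Set K, F.Finite ∧ F ⊆ O ∧ g ∈ Subgroup.closure F := by
  induction hg using Subgroup.closure_induction with
  | mem x hx => exact ⟨{x}, Set.finite_singleton x, by simpa, Subgroup.subset_closure rfl⟩
  | one => exact ⟨∅, Set.finite_empty, by simp, one_mem _⟩
  | mul x y _ _ hx hy =>
    obtain ⟨F, hF, hFO, hxF⟩ := hx
    obtain ⟨E, hE, hEO, hyE⟩ := hy
    exact ⟨F ∪ E, hF.union hE, Set.union_subset hFO hEO,
      mul_mem (Subgroup.closure_mono Set.subset_union_left hxF)
        (Subgroup.closure_mono Set.subset_union_right hyE)⟩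
  | inv x _ hx =>
    obtain ⟨F, hF, hFO, hxF⟩ := hx
    exact ⟨F, hF, hFO, inv_mem hxF⟩

theorem Subgroup.exists_finite_subset_subset_closure {K : Type*} [Group K] {O T : Set K}
    (hT : T.Finite) (h : T ⊆ Subgroup.closure O) :
    ∃ F : Set K, F.Finite ∧ F ⊆ O ∧ T ⊆ Subgroup.closure F := by
  induction T, hT using Set.Finite.induction_on with
  | empty => exact ⟨∅, Set.finite_empty, by simp, by simp⟩
  | insert _ _ ih =>
    rw [Set.insert_subset_iff] at h
    obtain ⟨F, hF, hFO, hFT⟩ := ih h.2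
    obtain ⟨E, hE, hEO, hEx⟩ := Subgroup.exists_finite_subset_mem_closure h.1
    exact ⟨E ∪ F, hE.union hF, Set.union_subset hEO hFO, Set.insert_subset
      (Subgroup.closure_mono Set.subset_union_left hEx)
      (hFT.trans (Subgroup.closure_mono Set.subset_union_right))⟩

/-- A compact subset of the subgroup generated by an arbitrary set `O` is covered by `⟨F⟩ * W`
for some finite `F ⊆ O`. -/
theorem IsCompact.exists_finite_subset_closure_mul {K : Type*} [Group K] [TopologicalSpace K]
    [IsTopologicalGroup K] {C O W : Set K} (hC : IsCompact C) (hCO : C ⊆ Subgroup.closure O)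
    (hW : W ∈ 𝓝 1) :
    ∃ F : Set K, F.Finite ∧ F ⊆ O ∧ C ⊆ (Subgroup.closure F : Set K) * W := by
  obtain ⟨t, htC, ht⟩ := hC.elim_nhds_subcover (fun x => {x} * W)
    (fun x _ => singleton_mul_mem_nhds_of_nhds_one x hW)
  obtain ⟨F, hF, hFO, htF⟩ := Subgroup.exists_finite_subset_subset_closure t.finite_toSet
    (fun x hx => hCO (htC x hx))
  refine ⟨F, hF, hFO, ht.trans (Set.iUnion₂_subset fun x hx => ?_)⟩
  exact Set.mul_subset_mul_right (Set.singleton_subset_iff.2 (htF hx))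

/-- If `O` is open and relatively compact, then finitely many elements of `O` generate a subgroup
which is `W`-dense in the subgroup generated by `O`. -/
theorem exists_finite_subset_closure_subset_closure_mul {K : Type*} [Group K] [TopologicalSpace K]
    [IsTopologicalGroup K] {O W : Set K} (hO : IsOpen O) (hOc : IsCompact (closure O))
    (hW : W ∈ 𝓝 1) :
    ∃ F : Set K, F.Finite ∧ F ⊆ O ∧
      (Subgroup.closure O : Set K) ⊆ (Subgroup.closure F : Set K) * W := by
  rcases O.eq_empty_or_nonempty with rfl | ⟨o, ho⟩
  · refine ⟨∅, Set.finite_empty, subset_rfl, fun g hg => ?_⟩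
    exact ⟨g, hg, 1, mem_of_mem_nhds hW, mul_one g⟩
  have hHcl : IsClosed (Subgroup.closure O : Set K) :=
    Subgroup.isClosed_of_isOpen _ (Subgroup.isOpen_of_mem_nhds _
      (mem_of_superset (hO.mem_nhds ho) Subgroup.subset_closure))
  have hOH : closure O ⊆ Subgroup.closure O := hHcl.closure_subset_iff.2 Subgroup.subset_closure
  set C : Set K := closure O ∪ (closure O)⁻¹ with hCdef
  have hC : IsCompact C := hOc.union hOc.inv
  have hCH : C ⊆ Subgroup.closure O := by
    rintro x (hx | hx)
    · exact hOH hx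
    · exact (inv_mem_iff (H := Subgroup.closure O)).1 (hOH hx)
  -- Covering `C * C` by `⟨F₁⟩ * o⁻¹ * O` and adding `o` to the generators gives `C * C ⊆ D * C`.
  -- Hence `D * C` absorbs right multiplication by `O` and `O⁻¹`, and so contains `⟨O⟩`.
  have hW' : ({o⁻¹} : Set K) * O ∈ 𝓝 1 := by
    refine (hO.mul_left).mem_nhds ⟨o⁻¹, rfl, o, ho, by simp⟩
  obtain ⟨F₁, hF₁, hF₁O, h₁⟩ := (hC.mul hC).exists_finite_subset_closure_mul (O := O)
    (by rintro _ ⟨a, ha, b, hb, rfl⟩; exact mul_mem (hCH ha) (hCH hb)) hW'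
  obtain ⟨F₂, hF₂, hF₂O, h₂⟩ := hC.exists_finite_subset_closure_mul (O := O) hCH hW
  refine ⟨F₁ ∪ F₂ ∪ {o}, (hF₁.union hF₂).union (Set.finite_singleton o),
    Set.union_subset (Set.union_subset hF₁O hF₂O) (by simpa), ?_⟩
  set D := Subgroup.closure (F₁ ∪ F₂ ∪ {o}) with hD
  have hD₁ : Subgroup.closure F₁ ≤ D := Subgroup.closure_mono fun x hx => .inl (.inl hx)
  have hD₂ : Subgroup.closure F₂ ≤ D := Subgroup.closure_mono fun x hx => .inl (.inr hx)
  have hoD : o ∈ D := Subgroup.subset_closure (.inr rfl)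
  have key : ∀ c ∈ C, ∀ c' ∈ C, ∀ d ∈ D, d * c * c' ∈ (D : Set K) * C := by
    intro c hc c' hc' d hd
    obtain ⟨f, hf, w, ⟨o', ho', u, hu, rfl⟩, hfw⟩ := h₁ (Set.mul_mem_mul hc hc')
    obtain rfl : o' = o⁻¹ := ho'
    refine ⟨d * (f * o⁻¹), mul_mem hd (mul_mem (hD₁ hf) (inv_mem hoD)), u,
      .inl (subset_closure hu), ?_⟩
    simp only at hfw
    simp only [mul_assoc] at hfw ⊢
    rw [← hfw]
  have hDC : (Subgroup.closure O : Set K) ⊆ (D : Set K) * C := by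
    intro g hg
    induction hg using Subgroup.closure_induction_right with
    | one => exact ⟨o⁻¹, inv_mem hoD, o, .inl (subset_closure ho), by simp⟩
    | mul_right x _ y hy ih =>
      obtain ⟨d, hd, c, hc, rfl⟩ := ih
      exact key c hc y (.inl (subset_closure hy)) d hd
    | mul_inv_cancel x _ y hy ih =>
      obtain ⟨d, hd, c, hc, rfl⟩ := ih
      exact key c hc y⁻¹ (.inr (by simpa using subset_closure hy)) d hd
  intro g hg
  obtain ⟨d, hd, c, hc, rfl⟩ := hDC hg
  obtain ⟨e, he, w, hw, rfl⟩ := h₂ hc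
  exact ⟨d * e, mul_mem hd (hD₂ he), w, hw, by simp [mul_assoc]⟩

/-- Along a decreasing sequence `V` of neighbourhoods of the identity, a compactly generated group
contains a set which generates a `V n`-dense subgroup and is almost contained in `V n`,
for every `n`. -/
theorem exists_set_finite_diff_and_closure_mul_eq_univ {K : Type*} [Group K] [TopologicalSpace K]
    [IsTopologicalGroup K] {O : Set K} (hO : IsOpen O) (hOc : IsCompact (closure O))
    (hgen : Subgroup.closure O = ⊤) {V : ℕ → Set K} (hV : ∀ n, V n ∈ 𝓝 1) (hanti : Antitone V)
    (hVc : IsCompact (closure (V 0))) :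
    ∃ Y : Set K, (∀ n, (Y \ V n).Finite) ∧
      ∀ n, (Subgroup.closure Y : Set K) * V n = Set.univ := by
  -- The index is shifted: `F (n + 1)` is chosen inside `V n` and approximates `⟨interior (V n)⟩` up
  -- to `V (n + 1)`. Thus only `F 0, …, F n` can leave `V n`, and each level corrects the error of
  -- the previous one.
  let P : ℕ → Set K := fun n => Nat.rec O (fun m _ => interior (V m)) n
  have hP : ∀ n, IsOpen (P n) := by
    rintro (_ | n)
    exacts [hO, isOpen_interior]
  have hPc : ∀ n, IsCompact (closure (P n)) := by
    rintro (_ | n)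
    · exact hOc
    · exact hVc.of_isClosed_subset isClosed_closure
        (closure_mono (interior_subset.trans (hanti (Nat.zero_le n))))
  choose F hF hFP hFc using fun n => exists_finite_subset_closure_subset_closure_mul (hP n) (hPc n)
    (interior_mem_nhds.2 (hV n))
  refine ⟨⋃ n, F n, fun n => ?_, fun n => ?_⟩
  · refine ((Set.finite_Iic n).biUnion fun m _ => hF m).subset ?_
    rintro y ⟨hy, hyV⟩
    obtain ⟨m, hm⟩ := Set.mem_iUnion.1 hy
    refine Set.mem_biUnion (x := m) ?_ hm
    by_contra hmn
    obtain ⟨k, rfl⟩ : ∃ k, m = k + 1 := ⟨m - 1, by simp at hmn; omega⟩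
    exact hyV (hanti (by simp at hmn; omega) (interior_subset (hFP _ hm)))
  · have hFY : ∀ m, Subgroup.closure (F m) ≤ Subgroup.closure (⋃ n, F n) := fun m =>
      Subgroup.closure_mono (Set.subset_iUnion F m)
    suffices h : ∀ n, (Subgroup.closure (⋃ n, F n) : Set K) * interior (V n) = Set.univ from
      Set.eq_univ_of_univ_subset ((h n).symm.subset.trans
        (Set.mul_subset_mul_left interior_subset))
    clear n
    intro n
    induction n with
    | zero =>
      refine Set.eq_univ_of_forall fun g => ?_
      have hg : g ∈ Subgroup.closure (P 0) := by
        change g ∈ Subgroup.closure O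
        simp [hgen]
      exact Set.mul_subset_mul_right (hFY 0) (hFc 0 hg)
    | succ n ih =>
      refine Set.eq_univ_of_forall fun g => ?_
      obtain ⟨a, ha, v, hv, rfl⟩ := ih.symm.subset (Set.mem_univ g)
      obtain ⟨b, hb, w, hw, rfl⟩ := hFc (n + 1)
        (Subgroup.subset_closure (show v ∈ P (n + 1) from hv))
      exact ⟨a * b, mul_mem ha (hFY _ hb), w, hw, by simp [mul_assoc]⟩

/-! ### Normal subgroups as countable intersections of neighbourhoods -/

/-- A neighbourhood of the identity contains a closed one, with small square, on which
conjugation by elements of a compact set is controlled. -/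
theorem exists_isClosed_nhds_one_conj_subset {G : Type*} [Group G] [TopologicalSpace G]
    [IsTopologicalGroup G] {C : Set G} (hC : IsCompact C) {W : Set G} (hW : W ∈ 𝓝 1) :
    ∃ V ∈ 𝓝 (1 : G), IsClosed V ∧ V⁻¹ = V ∧ V * V ⊆ W ∧ ∀ u ∈ C, ∀ v ∈ V, u * v * u⁻¹ ∈ W := by
  have hopen : IsOpen ((fun p : G × G => p.1 * p.2 * p.1⁻¹) ⁻¹' interior W) :=
    isOpen_interior.preimage (by fun_prop)
  obtain ⟨A, B, -, hB, hCA, h1B, hAB⟩ := generalized_tube_lemma hC (isCompact_singleton (x := (1 : G)))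
    hopen (by
      rintro ⟨u, v⟩ ⟨-, hv⟩
      obtain rfl : v = 1 := hv
      simpa using mem_interior_iff_mem_nhds.2 hW)
  obtain ⟨V, hV, hVcl, hVi, hVV⟩ := exists_closed_nhds_one_inv_eq_mul_subset
    (inter_mem hW (hB.mem_nhds (h1B rfl)))
  refine ⟨V, hV, hVcl, hVi, hVV.trans Set.inter_subset_left, fun u hu v hv => ?_⟩
  have hvB : v ∈ B := (hVV ⟨v, hv, 1, mem_of_mem_nhds hV, mul_one v⟩).2
  exact interior_subset (hAB (show (u, v) ∈ A ×ˢ B from ⟨hCA hu, hvB⟩))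

/-- In a compactly generated group, every neighbourhood of the identity contains a closed normal
subgroup which is the intersection of a decreasing sequence of neighbourhoods of the identity. -/
theorem exists_normal_eq_iInter_nhds {G : Type*} [Group G] [TopologicalSpace G]
    [IsTopologicalGroup G] {C : Set G} (hC : IsCompact C) (hgen : Subgroup.closure C = ⊤)
    {W : Set G} (hW : W ∈ 𝓝 1) :
    ∃ (V : ℕ → Set G) (L : Subgroup G), L.Normal ∧ (L : Set G) = ⋂ n, V n ∧ Antitone V ∧
      (∀ n, V n ∈ 𝓝 1) ∧ (∀ n, IsClosed (V n)) ∧ V 0 ⊆ W := by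
  have hC' : IsCompact (C ∪ C⁻¹) := hC.union hC.inv
  choose f hf hfcl hfi hff hfc using fun W : {W : Set G // W ∈ 𝓝 1} =>
    exists_isClosed_nhds_one_conj_subset hC' W.2
  -- Products from `V' (n + 1)`, and its conjugates by `C ∪ C⁻¹`, lie in `V' n`; in the intersection
  -- the loss of one index disappears.
  let V' : ℕ → {W : Set G // W ∈ 𝓝 1} := fun n =>
    Nat.rec ⟨f ⟨W, hW⟩, hf _⟩ (fun _ A => ⟨f A, hf A⟩) n
  have hself : ∀ W, f W ⊆ W := fun W v hv => hff W ⟨v, hv, 1, mem_of_mem_nhds (hf W), mul_one v⟩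
  have hcl : ∀ n, IsClosed (V' n).1 := by
    rintro (_ | n)
    exacts [hfcl _, hfcl _]
  have hinv : ∀ n, (V' n).1⁻¹ = (V' n).1 := by
    rintro (_ | n)
    exacts [hfi _, hfi _]
  have hsucc : ∀ n, (V' (n + 1)).1 = f (V' n) := fun n => rfl
  let L : Subgroup G :=
    { carrier := ⋂ n, (V' n).1
      one_mem' := Set.mem_iInter.2 fun n => mem_of_mem_nhds (V' n).2
      mul_mem' := fun {a b} ha hb => Set.mem_iInter.2 fun n => hff (V' n)
        ⟨a, Set.mem_iInter.1 ha (n + 1), b, Set.mem_iInter.1 hb (n + 1), rfl⟩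
      inv_mem' := fun {a} ha => Set.mem_iInter.2 fun n => by
        rw [← hinv n]
        simpa using Set.mem_iInter.1 ha n }
  have hconj : ∀ u ∈ C ∪ C⁻¹, ∀ m ∈ L, u * m * u⁻¹ ∈ L := fun u hu m hm =>
    Set.mem_iInter.2 fun n => hfc (V' n) u hu m (Set.mem_iInter.1 hm (n + 1))
  refine ⟨fun n => (V' n).1, L, ⟨fun m hm g => ?_⟩, rfl, antitone_nat_of_succ_le fun n => hself _,
    fun n => (V' n).2, hcl, hself _⟩
  have hg : g ∈ Subgroup.closure C := by simp [hgen]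
  induction hg using Subgroup.closure_induction_left with
  | one => simpa
  | mul_left x hx y _ ih =>
    have := hconj x (.inl hx) _ ih
    simpa [mul_assoc] using this
  | inv_mul_cancel x hx y _ ih =>
    have := hconj x⁻¹ (.inr (by simpa)) _ ih
    simpa [mul_assoc] using this

/-! ### Families modulo a compact normal subgroup -/

theorem Subgroup.coe_mul_mem_nhds {G : Type*} [Group G] [TopologicalSpace G]
    [IsTopologicalGroup G] (N : Subgroup G) {W : Set G} (hW : W ∈ 𝓝 1) {x : G} (hx : x ∈ N) :
    (N : Set G) * W ∈ 𝓝 x :=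
  mem_of_superset (singleton_mul_mem_nhds_of_nhds_one x hW)
    (Set.mul_subset_mul_right (Set.singleton_subset_iff.2 hx))

/-- The family `x` is null and topologically generating modulo the compact normal subgroup `N`,
and the terms whose first index lies below `N` are trivial modulo `N`. -/
structure IsSuitableFamilyMod {G : Type*} [Group G] [TopologicalSpace G] (N : Subgroup G)
    (x : Subgroup G × G → G) : Prop where
  normal : N.Normal
  isCompact : IsCompact (N : Set G)
  eventually_mem : ∀ W ∈ 𝓝 (1 : G), ∀ᶠ j in cofinite, x j ∈ (N : Set G) * W
  dense : ∀ W ∈ 𝓝 (1 : G), ∀ g : G,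
    ∃ h ∈ Subgroup.closure (Set.range x), ∃ n ∈ N, ∃ w ∈ W, h * n * w = g
  mem_of_le : ∀ j : Subgroup G × G, j.1 ≤ N → x j ∈ N

/-- Each `x j` lies in `⟨range x'⟩ ⊔ N`, which is a product set because `N` is normal. This carries
density over to a congruent family. -/
theorem exists_mul_of_mem_closure_range {G ι : Type*} [Group G] {N : Subgroup G} [N.Normal]
    {x x' : ι → G} (h : ∀ j, x' j * (x j)⁻¹ ∈ N) {g : G}
    (hg : g ∈ Subgroup.closure (Set.range x)) :
    ∃ a ∈ Subgroup.closure (Set.range x'), ∃ n ∈ N, a * n = g := by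
  refine Subgroup.mem_sup_of_normal_right.1
    ((Subgroup.closure_le (Subgroup.closure (Set.range x') ⊔ N)).2 ?_ hg)
  rintro _ ⟨j, rfl⟩
  have h1 : x' j ∈ Subgroup.closure (Set.range x') ⊔ N :=
    Subgroup.mem_sup_left (Subgroup.subset_closure ⟨j, rfl⟩)
  have h2 := mul_mem (inv_mem (Subgroup.mem_sup_right (S := Subgroup.closure (Set.range x')) (h j))) h1
  simpa using h2

theorem exists_nhds_one_mul_subset {G : Type*} [Group G] [TopologicalSpace G]
    [IsTopologicalGroup G] {W : Set G} (hW : W ∈ 𝓝 1) : ∃ V ∈ 𝓝 (1 : G), V * V ⊆ W := by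
  obtain ⟨V, hV, -, -, h⟩ := exists_closed_nhds_one_inv_eq_mul_subset hW
  exact ⟨V, hV, h⟩

theorem exists_isSuitableFamilyMod_of_isCompact_nhds {G : Type*} [Group G] [TopologicalSpace G]
    [IsTopologicalGroup G] {V : ℕ → Set G} {L : Subgroup G} (hL : L.Normal)
    (hLV : (L : Set G) = ⋂ n, V n) (hanti : Antitone V)
    (hVcl : ∀ n, IsClosed (V n)) (hVc : IsCompact (V 0))
    {Y : Set G} (hYfin : ∀ n, (Y \ V n).Finite)
    (hY : ∀ n, (Subgroup.closure Y : Set G) * V n = Set.univ) :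
    ∃ x, IsSuitableFamilyMod L x := by
  classical
  have hVc' : ∀ n, IsCompact (V n) := fun n => hVc.of_isClosed_subset (hVcl n) (hanti n.zero_le)
  have hVL : ∀ W ∈ 𝓝 (1 : G), ∃ n, V n ⊆ (L : Set G) * W := fun W hW =>
    exists_subset_nhds_of_isCompact' (directed_of_isDirected_le hanti) hVc' hVcl
      fun x hx => L.coe_mul_mem_nhds hW (hLV.symm.subset hx)
  -- The generators occupy the slots under `⊤`: such an index lies below `L` only if `L = ⊤`, when
  -- triviality modulo `L` is automatic.
  refine ⟨fun j => if j.1 = ⊤ ∧ j.2 ∈ Y then j.2 else 1, hL, ?_, fun W hW => ?_, fun W hW g => ?_,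
    fun j hj => ?_⟩
  · exact hVc.of_isClosed_subset (hLV ▸ isClosed_iInter hVcl)
      (hLV.subset.trans (Set.iInter_subset _ _))
  · obtain ⟨n, hn⟩ := hVL W hW
    refine (((Set.finite_singleton (⊤ : Subgroup G)).prod (hYfin n))).subset ?_
    rintro ⟨M, g⟩ hg
    by_cases hMg : M = ⊤ ∧ g ∈ Y
    · refine ⟨hMg.1, hMg.2, fun hgV => hg ?_⟩
      simpa [hMg] using hn hgV
    · exact absurd ⟨1, L.one_mem, 1, mem_of_mem_nhds hW, by simp [hMg]⟩ hg
  · obtain ⟨n, hn⟩ := hVL W hW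
    obtain ⟨a, ha, v, hv, rfl⟩ := (hY n).symm.subset (Set.mem_univ g)
    obtain ⟨m, hm, w, hw, rfl⟩ := hn hv
    refine ⟨a, Subgroup.closure_mono (fun y hy => by
      exact ⟨(⊤, y), by simp [hy]⟩) ha, m, hm, w, hw,
      by simp [mul_assoc]⟩
  · split_ifs with h
    · exact hj (h.1 ▸ Subgroup.mem_top _)
    · exact L.one_mem

/-! ### Successor and limit steps -/

/-- Lifting a point along a compact coset into all those members of a decreasing sequence of closed
sets which meet the coset. -/
theorem exists_mem_coset_forall_mem {G : Type*} [Group G] [TopologicalSpace G]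
    [IsTopologicalGroup G] [T2Space G] {N : Subgroup G} (hN : IsCompact (N : Set G)) {V : ℕ → Set G}
    (hanti : Antitone V) (hVcl : ∀ n, IsClosed (V n)) (x : G) :
    ∃ z, z * x⁻¹ ∈ N ∧ ∀ n, x ∈ (N : Set G) * V n → z ∈ V n := by
  rcases isEmpty_or_nonempty {n // x ∈ (N : Set G) * V n} with h | h
  · exact ⟨x, by simp, fun n hn => (h.false ⟨n, hn⟩).elim⟩
  have hc : IsCompact ((N : Set G) * {x}) := hN.mul isCompact_singleton
  obtain ⟨z, hz⟩ := IsCompact.nonempty_iInter_of_directed_nonempty_isCompact_isClosed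
    (fun n : {n // x ∈ (N : Set G) * V n} => ((N : Set G) * {x}) ∩ V n)
    (directed_of_isDirected_le fun a b hab => Set.inter_subset_inter_right _ (hanti hab))
    (by
      rintro ⟨n, k, hk, v, hv, hkv⟩
      refine ⟨v, ⟨k⁻¹, inv_mem hk, x, rfl, ?_⟩, hv⟩
      simp only at hkv
      simp [← hkv])
    (fun n => hc.inter_right (hVcl n)) (fun n => hc.isClosed.inter (hVcl n))
  rw [Set.mem_iInter] at hz
  refine ⟨z, ?_, fun n hn => (hz ⟨n, hn⟩).2⟩
  obtain ⟨k, hk, y, rfl, rfl⟩ := (hz h.some).1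
  simpa using hk

/-- The slots `(N, g)` receive `Y`, which supplies the part of `N` missing modulo `N ⊓ L`. Every
other term moves within its `N`-coset into all the `V n` that the coset meets, which makes the
family null modulo `N ⊓ L`. -/
theorem IsSuitableFamilyMod.exists_refinement {G : Type*} [Group G] [TopologicalSpace G]
    [IsTopologicalGroup G] [T2Space G] {N : Subgroup G} {x : Subgroup G × G → G}
    (hx : IsSuitableFamilyMod N x) {V : ℕ → Set G} {L : Subgroup G} (hL : L.Normal)
    (hLV : (L : Set G) = ⋂ n, V n) (hanti : Antitone V) (hV : ∀ n, V n ∈ 𝓝 1)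
    (hVcl : ∀ n, IsClosed (V n)) (hNL : ¬ N ≤ L) {Y : Set G} (hYN : Y ⊆ N)
    (hYfin : ∀ n, (Y \ V n).Finite)
    (hY : ∀ n, (N : Set G) ⊆ (Subgroup.closure Y : Set G) * ((N : Set G) ∩ V n)) :
    ∃ x', IsSuitableFamilyMod (N ⊓ L) x' ∧ ∀ j, x' j * (x j)⁻¹ ∈ N := by
  classical
  have := hx.normal
  have hNc := hx.isCompact
  have hMV : ∀ y, y ∈ N ⊓ L ↔ y ∈ N ∧ ∀ n, y ∈ V n := fun y => by
    rw [Subgroup.mem_inf, ← SetLike.mem_coe (A := Subgroup G) (p := L), hLV, Set.mem_iInter]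
  have hVN : ∀ W ∈ 𝓝 (1 : G), ∃ n, (N : Set G) ∩ V n ⊆ ((N ⊓ L : Subgroup G) : Set G) * W := by
    intro W hW
    refine exists_subset_nhds_of_isCompact'
      (directed_of_isDirected_le fun a b hab => Set.inter_subset_inter_right _ (hanti hab))
      (fun n => hNc.inter_right (hVcl n)) (fun n => hNc.isClosed.inter (hVcl n))
      fun y hy => (N ⊓ L).coe_mul_mem_nhds hW ((hMV y).2 ?_)
    rw [Set.mem_iInter] at hy
    exact ⟨(hy 0).1, fun n => (hy n).2⟩
  choose z hzN hzV using fun j => exists_mem_coset_forall_mem hNc hanti hVcl (x j)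
  let x' : Subgroup G × G → G := fun j => if j.1 = N then (if j.2 ∈ Y then j.2 else 1) else z j
  have hx'N : ∀ g, x' (N, g) = if g ∈ Y then g else 1 := fun g => if_pos rfl
  have hx'z : ∀ j : Subgroup G × G, j.1 ≠ N → x' j = z j := fun j hj => if_neg hj
  have hxx' : ∀ j, x' j * (x j)⁻¹ ∈ N := by
    intro j
    by_cases hj : j.1 = N
    · obtain ⟨M, g⟩ := j
      obtain rfl : M = N := hj
      refine mul_mem ?_ (inv_mem (hx.mem_of_le _ le_rfl))
      rw [hx'N]
      split_ifs with h
      exacts [hYN h, one_mem _]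
    · rw [hx'z j hj]
      exact hzN j
  refine ⟨x', ⟨inferInstance, ?_, fun W hW => ?_, fun W hW g => ?_, fun j hj => ?_⟩, hxx'⟩
  · rw [Subgroup.coe_inf, hLV]
    exact hNc.inter_right (isClosed_iInter hVcl)
  · obtain ⟨W₁, hW₁, hWW⟩ := exists_nhds_one_mul_subset hW
    obtain ⟨n, hn⟩ := hVN (interior W₁) (interior_mem_nhds.2 hW₁)
    -- The part of `N` outside `(N ⊓ L) * interior W₁` is compact and misses `V n`, and still does
    -- after right multiplication by `W'`. So if `z j ∈ V n` is an element of `N` times one of `W'`,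
    -- the `N`-factor lies in `(N ⊓ L) * interior W₁`.
    obtain ⟨W', hW', hsep⟩ := compact_open_separated_mul_right
      (K := (N : Set G) \ (((N ⊓ L : Subgroup G) : Set G) * interior W₁)) (U := (V n)ᶜ)
      (hNc.diff isOpen_interior.mul_left) (hVcl n).isOpen_compl
      (fun y hy hyV => hy.2 (hn ⟨hy.1, hyV⟩))
    have h1 : ∀ᶠ j in cofinite, x' j ∈ ((N ⊓ L : Subgroup G) : Set G) * W ∨ j.1 ≠ N := by
      refine ((Set.finite_singleton N).prod (hYfin n)).subset ?_
      rintro ⟨M, g⟩ hg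
      simp only [Set.mem_compl_iff, Set.mem_ofPred_eq, not_or, not_not] at hg
      obtain ⟨hg, rfl⟩ := hg
      rw [hx'N] at hg
      split_ifs at hg with hgY
      · refine ⟨rfl, hgY, fun hgV => hg ?_⟩
        exact Set.mul_subset_mul_left (interior_subset.trans fun w hw =>
          hWW ⟨w, hw, 1, mem_of_mem_nhds hW₁, mul_one w⟩) (hn ⟨hYN hgY, hgV⟩)
      · exact absurd ⟨1, one_mem _, 1, mem_of_mem_nhds hW, by simp⟩ hg
    filter_upwards [h1, hx.eventually_mem _ (hV n), hx.eventually_mem _ (inter_mem hW₁ hW')]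
      with j hj hjV hjW
    refine hj.elim id fun hjN => ?_
    rw [hx'z j hjN]
    obtain ⟨k, hk, w, hw, hkw⟩ := hjW
    have hz : z j = z j * (x j)⁻¹ * k * w := by
      simp only at hkw
      simp [mul_assoc, hkw]
    have hk' := mul_mem (hzN j) hk
    have hkM : z j * (x j)⁻¹ * k ∈ ((N ⊓ L : Subgroup G) : Set G) * interior W₁ := by
      by_contra hcon
      refine hsep ⟨_, ⟨hk', hcon⟩, w, hw.2, rfl⟩ ?_
      simp only
      rw [← hz]
      exact hzV j n hjV
    obtain ⟨m, hm, w₁, hw₁, hmw⟩ := hkM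
    refine ⟨m, hm, w₁ * w, hWW ⟨w₁, interior_subset hw₁, w, hw.1, rfl⟩, ?_⟩
    rw [hz, ← hmw]
    simp [mul_assoc]
  · obtain ⟨W₁, hW₁, hWW⟩ := exists_nhds_one_mul_subset hW
    obtain ⟨n, hn⟩ := hVN W₁ hW₁
    obtain ⟨h, hh, k, hk, w, hw, rfl⟩ := hx.dense W₁ hW₁ g
    obtain ⟨a, ha, k', hk', rfl⟩ := exists_mul_of_mem_closure_range hxx' hh
    obtain ⟨b, hb, v, hv, hbv⟩ := hY n (mul_mem hk' hk)
    obtain ⟨m, hm, w₁, hw₁, rfl⟩ := hn hv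
    have hYx' : Y ⊆ Set.range x' := fun y hy => ⟨(N, y), by rw [hx'N, if_pos hy]⟩
    refine ⟨a * b, mul_mem ha (Subgroup.closure_mono hYx' hb), m, hm,
      w₁ * w, hWW ⟨w₁, hw₁, w, hw, rfl⟩, ?_⟩
    simp only at hbv
    rw [mul_assoc a k' k, ← hbv]
    simp [mul_assoc]
  · have hjN : j.1 ≠ N := fun h => hNL (h ▸ hj.trans inf_le_right)
    have hxN : x j ∈ N := hx.mem_of_le j (hj.trans inf_le_left)
    rw [hx'z j hjN, hMV]
    refine ⟨by simpa using mul_mem (hzN j) hxN, fun n => hzV j n ?_⟩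
    exact ⟨x j, hxN, 1, mem_of_mem_nhds (hV n), mul_one _⟩

/-- For fixed `j` the compact cosets `N i * x i j` are directed downwards, so they share a point,
which is the limit term. Compactness also puts some `N i` inside `(⨅ i, N i) * W`, so nullness and
density pass down from that stage. -/
theorem exists_isSuitableFamilyMod_iInf {G : Type*} [Group G] [TopologicalSpace G]
    [IsTopologicalGroup G] [T2Space G] {ι : Type*} [Nonempty ι] {N : ι → Subgroup G}
    {x : ι → Subgroup G × G → G} (hx : ∀ i, IsSuitableFamilyMod (N i) (x i))
    (hdir : Directed (fun a b => N b ≤ N a ∧ ∀ j, x b j * (x a j)⁻¹ ∈ N a) id) :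
    ∃ x', IsSuitableFamilyMod (⨅ i, N i) x' ∧ ∀ i j, x' j * (x i j)⁻¹ ∈ N i := by
  have hNn := fun i => (hx i).normal
  have hNc := fun i => (hx i).isCompact
  have hlim : ∀ j, ∃ z, ∀ i, z * (x i j)⁻¹ ∈ N i := by
    intro j
    have hc : ∀ i, IsCompact ((N i : Set G) * {x i j}) := fun i => (hNc i).mul isCompact_singleton
    obtain ⟨z, hz⟩ := IsCompact.nonempty_iInter_of_directed_nonempty_isCompact_isClosed
      (fun i => (N i : Set G) * {x i j})
      (by
        intro a b
        obtain ⟨c, hac, hbc⟩ := hdir a b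
        refine ⟨c, ?_, ?_⟩
        · rintro _ ⟨k, hk, _, rfl, rfl⟩
          exact ⟨k * (x c j * (x a j)⁻¹), mul_mem (hac.1 hk) (hac.2 j), _, rfl, by simp [mul_assoc]⟩
        · rintro _ ⟨k, hk, _, rfl, rfl⟩
          exact ⟨k * (x c j * (x b j)⁻¹), mul_mem (hbc.1 hk) (hbc.2 j), _, rfl, by simp [mul_assoc]⟩)
      (fun i => ⟨x i j, Set.mem_mul.2 ⟨1, one_mem _, x i j, rfl, one_mul _⟩⟩) hc (fun i => (hc i).isClosed)
    refine ⟨z, fun i => ?_⟩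
    obtain ⟨k, hk, _, rfl, rfl⟩ := Set.mem_iInter.1 hz i
    simpa using hk
  choose z hz using hlim
  have hNW : ∀ W ∈ 𝓝 (1 : G), ∃ i, (N i : Set G) ⊆ ((⨅ i, N i : Subgroup G) : Set G) * W := by
    intro W hW
    refine exists_subset_nhds_of_isCompact' ?_ hNc (fun i => (hNc i).isClosed)
      fun y hy => (⨅ i, N i).coe_mul_mem_nhds hW ?_
    · intro a b
      obtain ⟨c, hac, hbc⟩ := hdir a b
      exact ⟨c, hac.1, hbc.1⟩
    · simpa [Subgroup.mem_iInf] using hy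
  refine ⟨z, ⟨Subgroup.normal_iInf_normal hNn, ?_, fun W hW => ?_, fun W hW g => ?_,
    fun j hj => ?_⟩, fun i j => hz j i⟩
  · rw [Subgroup.coe_iInf]
    exact (hNc (Classical.arbitrary ι)).of_isClosed_subset
      (isClosed_iInter fun i => (hNc i).isClosed) (Set.iInter_subset _ _)
  · obtain ⟨W₁, hW₁, hWW⟩ := exists_nhds_one_mul_subset hW
    obtain ⟨i, hi⟩ := hNW W₁ hW₁
    filter_upwards [(hx i).eventually_mem W₁ hW₁] with j hj
    obtain ⟨k, hk, w, hw, hkw⟩ := hj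
    obtain ⟨m, hm, w₁, hw₁, hmw⟩ := hi (mul_mem (hz j i) hk)
    refine ⟨m, hm, w₁ * w, hWW ⟨w₁, hw₁, w, hw, rfl⟩, ?_⟩
    simp only at hkw hmw ⊢
    rw [← mul_assoc, hmw, mul_assoc _ k w, hkw]
    simp
  · obtain ⟨W₁, hW₁, hWW⟩ := exists_nhds_one_mul_subset hW
    obtain ⟨i, hi⟩ := hNW W₁ hW₁
    obtain ⟨h, hh, k, hk, w, hw, rfl⟩ := (hx i).dense W₁ hW₁ g
    obtain ⟨a, ha, k', hk', rfl⟩ := exists_mul_of_mem_closure_range (fun j => hz j i) hh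
    obtain ⟨m, hm, w₁, hw₁, hmw⟩ := hi (mul_mem hk' hk)
    refine ⟨a, ha, m, hm, w₁ * w, hWW ⟨w₁, hw₁, w, hw, rfl⟩, ?_⟩
    simp only at hmw
    rw [mul_assoc a k' k, ← hmw]
    simp [mul_assoc]
  · refine Subgroup.mem_iInf.2 fun i => ?_
    simpa using mul_mem (hz j i) ((hx i).mem_of_le j (hj.trans (iInf_le N i)))

/-! ### From minimal families to suitable sets -/

/-- A null topologically generating family gives a suitable set. -/
theorem IsSuitableFamilyMod.exists_isSuitableSet {G : Type*} [Group G] [TopologicalSpace G]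
    [IsTopologicalGroup G] [T2Space G] {x : Subgroup G × G → G}
    (hx : IsSuitableFamilyMod (⊥ : Subgroup G) x) :
    ∃ S : Set G, IsSuitableSet S ∧ IsCompact (S ∪ {1}) := by
  have hlim : Tendsto x cofinite (𝓝 1) := by
    intro W hW
    filter_upwards [hx.eventually_mem W hW] with j hj
    simpa using hj
  have hS : (Set.range x \ {1}) ∪ {1} = insert 1 (Set.range x) := by
    rw [Set.sdiff_union_self, Set.union_singleton]
  have hc : IsCompact (Set.range x \ {1} ∪ {1}) := hS ▸ hlim.isCompact_insert_range_of_cofinite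
  refine ⟨Set.range x \ {1}, ⟨?_, hc.isClosed, ?_⟩, hc⟩
  · rw [isDiscrete_iff_forall_mem_exists_isOpen]
    rintro y ⟨hy, hy1⟩
    -- All but finitely many terms lie in `B`, so `A` meets the set in finitely many points;
    -- removing those other than `y` isolates `y`.
    obtain ⟨A, B, hA, hB, hyA, h1B, hAB⟩ := t2_separation (show y ≠ 1 from hy1)
    have hfin : (A ∩ (Set.range x \ {1})).Finite := by
      have : {j | ¬ x j ∈ B}.Finite := hlim (hB.mem_nhds h1B)
      refine (this.image x).subset ?_
      rintro _ ⟨ha, ⟨j, rfl⟩, -⟩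
      exact ⟨j, fun hb => Set.disjoint_left.1 hAB ha hb, rfl⟩
    refine ⟨A \ ((A ∩ (Set.range x \ {1})) \ {y}), hA.sdiff hfin.sdiff.isClosed, ?_⟩
    ext a
    constructor
    · rintro ⟨⟨haA, ha⟩, haS⟩
      by_contra hay
      exact ha ⟨⟨haA, haS⟩, hay⟩
    · rintro rfl
      exact ⟨⟨hyA, fun h => h.2 rfl⟩, hy, hy1⟩
  · have hcl : Subgroup.closure (Set.range x \ {1}) = Subgroup.closure (Set.range x) := by
      rw [← Subgroup.closure_insert_one, ← Subgroup.closure_insert_one (Set.range x),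
        Set.insert_sdiff_singleton]
    rw [hcl]
    intro g
    rw [mem_closure_iff_nhds]
    intro T hT
    have hT' : {w : G | g * w⁻¹ ∈ T} ∈ 𝓝 (1 : G) :=
      (show Continuous fun w : G => g * w⁻¹ by fun_prop).continuousAt.preimage_mem_nhds
        (by simpa using hT)
    obtain ⟨h, hh, n, hn, w, hw, hg⟩ := hx.dense _ hT' g
    obtain rfl := Subgroup.mem_bot.1 hn
    refine ⟨h, ?_, hh⟩
    have : g * w⁻¹ = h := by rw [← hg]; simp
    exact this ▸ hw

/-- A neighbourhood of `1` avoiding some `y ≠ 1` of `N` contains a normal `L` with `y ∉ L`, so `N ⊓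
L` is strictly smaller. New generators come from the compact group `N` itself, with `Set.univ` as
its relatively compact open generating set. -/
theorem IsSuitableFamilyMod.exists_lt {G : Type*} [Group G] [TopologicalSpace G]
    [IsTopologicalGroup G] [T2Space G] {C : Set G} (hC : IsCompact C)
    (hgen : Subgroup.closure C = ⊤) {N : Subgroup G} {x : Subgroup G × G → G}
    (hx : IsSuitableFamilyMod N x) (hN : N ≠ ⊥) :
    ∃ M x', IsSuitableFamilyMod M x' ∧ M < N ∧ ∀ j, x' j * (x j)⁻¹ ∈ N := by
  obtain ⟨y, hyN, hy⟩ := N.bot_or_exists_ne_one.resolve_left hN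
  obtain ⟨V, L, hL, hLV, hanti, hV, hVcl, hVy⟩ := exists_normal_eq_iInter_nhds hC hgen
    (isOpen_compl_singleton.mem_nhds (show (1 : G) ∈ {y}ᶜ from fun h => hy h.symm))
  have hNL : ¬ N ≤ L := fun h => hVy (Set.mem_iInter.1 (hLV.subset (h hyN)) 0) rfl
  have : CompactSpace N := isCompact_iff_compactSpace.1 hx.isCompact
  obtain ⟨Y, hYfin, hY⟩ := exists_set_finite_diff_and_closure_mul_eq_univ (K := N)
    isOpen_univ isClosed_closure.isCompact Subgroup.closure_univ
    (V := fun n => N.subtype ⁻¹' V n)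
    (fun n => continuous_subtype_val.continuousAt.preimage_mem_nhds (hV n))
    (fun a b hab => Set.preimage_mono (hanti hab)) isClosed_closure.isCompact
  obtain ⟨x', hx', h⟩ := hx.exists_refinement hL hLV hanti hV hVcl hNL
    (Y := N.subtype '' Y) (by rintro _ ⟨y, -, rfl⟩; exact y.2)
    (fun n => ((hYfin n).image N.subtype).subset (by
      rintro _ ⟨⟨y, hy, rfl⟩, hyV⟩
      exact ⟨y, ⟨hy, hyV⟩, rfl⟩))
    (fun n k hk => by
      obtain ⟨a, ha, v, hv, hav⟩ := (hY n).symm.subset (Set.mem_univ (⟨k, hk⟩ : N))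
      refine ⟨a, ?_, v, ⟨v.2, hv⟩, congrArg Subtype.val hav⟩
      rw [← MonoidHom.map_closure]
      exact ⟨a, ha, rfl⟩)
  exact ⟨N ⊓ L, x', hx', inf_lt_left.2 hNL, h⟩

theorem exists_isSuitableFamilyMod {G : Type*} [Group G] [TopologicalSpace G]
    [IsTopologicalGroup G] {U : Set G} (hU : IsOpen U)
    (hUc : IsCompact (closure U)) (hgen : Subgroup.closure U = ⊤) :
    ∃ (N : Subgroup G) (x : Subgroup G × G → G), IsSuitableFamilyMod N x := by
  have hgen' : Subgroup.closure (closure U) = ⊤ :=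
    top_le_iff.1 (hgen.symm.trans_le (Subgroup.closure_mono subset_closure))
  obtain ⟨K, hK, hKc⟩ : ∃ K ∈ 𝓝 (1 : G), IsCompact (closure K) := by
    rcases U.eq_empty_or_nonempty with rfl | ⟨u, hu⟩
    -- The empty set generates only the trivial group.
    · have : Subsingleton G := Subgroup.subsingleton_iff.1
        (subsingleton_of_bot_eq_top (by rw [← hgen, Subgroup.closure_empty]))
      exact ⟨Set.univ, univ_mem, Set.subsingleton_of_subsingleton.isCompact⟩
    · have : LocallyCompactSpace G := hUc.locallyCompactSpace_of_mem_nhds_of_group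
        (mem_of_superset (hU.mem_nhds hu) subset_closure)
      obtain ⟨K, hK, hK1⟩ := exists_compact_mem_nhds (1 : G)
      exact ⟨K, hK1, hK.closure⟩
  obtain ⟨V, L, hL, hLV, hanti, hV, hVcl, hVK⟩ := exists_normal_eq_iInter_nhds hUc hgen' hK
  have hVc : IsCompact (V 0) := hKc.of_isClosed_subset (hVcl 0) (hVK.trans subset_closure)
  obtain ⟨Y, hYfin, hY⟩ := exists_set_finite_diff_and_closure_mul_eq_univ hU hUc hgen hV hanti
    (by rwa [(hVcl 0).closure_eq])
  exact ⟨L, exists_isSuitableFamilyMod_of_isCompact_nhds hL hLV hanti hVcl hVc hYfin hY⟩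

theorem theorem4p1 {G : Type*} [Group G] [TopologicalSpace G] [IsTopologicalGroup G] [T2Space G]
    (U : Set G) (hU : IsOpen U) (hUc : IsCompact (closure U)) (hgen : Subgroup.closure U = ⊤) :
    ∃ S : Set G, IsSuitableSet S ∧ IsCompact (S ∪ {1}) := by
  let α := {p : Subgroup G × (Subgroup G × G → G) // IsSuitableFamilyMod p.1 p.2}
  -- Congruence modulo the larger subgroup `a.1.1` keeps the cosets along a chain nested; maximal
  -- for `r` means minimal `N`.
  let r : α → α → Prop := fun a b => b.1.1 ≤ a.1.1 ∧ ∀ j, b.1.2 j * (a.1.2 j)⁻¹ ∈ a.1.1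
  have hrefl : ∀ a, r a a := fun a => ⟨le_rfl, fun j => by simp⟩
  obtain ⟨N₀, x₀, h₀⟩ := exists_isSuitableFamilyMod hU hUc hgen
  have : Nonempty α := ⟨⟨(N₀, x₀), h₀⟩⟩
  obtain ⟨⟨⟨N, x⟩, hx⟩, hmax⟩ := exists_maximal_of_nonempty_chains_bounded (r := r)
    (by
      intro c hc hcne
      have : Nonempty c := hcne.to_subtype
      obtain ⟨x', hx', h⟩ := exists_isSuitableFamilyMod_iInf (fun a : c => a.1.2)
        (by
          intro a b
          by_cases hab : a = b
          · exact ⟨b, hab ▸ hrefl a, hrefl b⟩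
          · rcases hc a.2 b.2 (Subtype.coe_ne_coe.2 hab) with h | h
            · exact ⟨b, h, hrefl _⟩
            · exact ⟨a, hrefl _, h⟩)
      exact ⟨⟨(_, x'), hx'⟩, fun a ha => ⟨iInf_le _ (⟨a, ha⟩ : c), h ⟨a, ha⟩⟩⟩)
    (by
      intro a b c hab hbc
      refine ⟨hbc.1.trans hab.1, fun j => ?_⟩
      simpa using mul_mem (hab.1 (hbc.2 j)) (hab.2 j))
  rcases eq_or_ne N ⊥ with rfl | hN
  · exact hx.exists_isSuitableSet
  have hgen' : Subgroup.closure (closure U) = ⊤ :=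
    top_le_iff.1 (hgen.symm.trans_le (Subgroup.closure_mono subset_closure))
  obtain ⟨M, x', hx', hMN, h⟩ := hx.exists_lt hUc hgen' hN
  exact absurd (hmax ⟨(M, x'), hx'⟩ ⟨hMN.le, h⟩).1 hMN.not_ge
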